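/- Let $k$ be a perfect field. An algebra filtration of a finite-dimensional Lie algebra $L$ over $k$ is a family $F_\bullet=(F_m)_{m\in\mathbb Z}$ of subspaces with $F_i\supseteq F_j$ for $i\le j$, $[F_i,F_j]\subseteq F_{i+j}$ for all $i,j$, $F_m=L$ for $m\ll 0$ and $F_m=0$ for $m\gg 0$; it is trivial if $F_m=L$ for $m\le 0$ and $F_m=0$ for $m>0$. Put $$\mathrm{wt}(L,F_\bullet)=\sum_{m}m\dim(F_m/F_{m+1}),\qquad \|F_\bullet\|=\Bigl(\sum_m m^2\dim(F_m/F_{m+1})\Bigr)^{1/2},\qquad \nu(L,F_\bullet)=\frac{-\mathrm{wt}(L,F_\bullet)}{\|F_\bullet\|},$$ where $\nu$ of the trivial filtration is taken to be $0$. $L$ is semistable if $-\mathrm{wt}(L,F_\bullet)\ge 0$ for every filtration, and unstable otherwise. A canonical filtration of $L$ is the trivial filtration if $L$ is semistable, and a filtration minimizing $\nu(L,-)$ over all filtrations of $L$ if $L$ is unstable. For $n\ge 1$ let $M_n$ be the model filiform Lie algebra: the $(n+1)$-dimensional Lie algebra over $k$ with a basis $e_0,\dots,e_n$ whose only non-zero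 brackets of basis vectors are $[e_0,e_i]=e_{i+1}=-[e_i,e_0]$ for $1\le i\le n-1$. Let $x_0,\dots,x_n$ be any Vergne basis of $M_n$, that is, a basis with $[x_0,x_i]=x_{i+1}$ for $1\le i\le n-1$, $[x_1,x_{n-1}]=0$, and $[x_i,x_j]\in\mathrm{Span}(x_l : i+j\le l\le n)$ for all $i,j$. Set $$w(x_0)=12,\qquad w(x_i)=n^3-7n+18+12(i-1)\quad(1\le i\le n).$$ Then $F_m=\mathrm{Span}(x_i : w(x_i)\ge m)$, $m\in\mathbb Z$, is an algebra filtration of $M_n$ and is a canonical filtration of $M_n$. It is the only one up to positive rescaling of the weights: a filtration $G_\bullet$ of $M_n$ is canonical if and only if there are positive integers $p,q$ such that multiplying all weights of $G_\bullet$ by $p$ and all weights of $F_\bullet$ by $q$ gives the same filtration, i.e. $G_{\lceil m/p\rceil}=F_{\lceil m/q\rceil}$ for all $m\in\mathbb Z$. -/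

import Mathlib

/-- An algebra filtration of a Lie algebra `L` over `k`: a decreasing `ℤ`-indexed family of
subspaces, compatible with the bracket, equal to `L` far to the left and to `0` far to the
right. -/
structure LieAlgFiltration (k L : Type*) [Field k] [LieRing L] [LieAlgebra k L] where
  piece : ℤ → Submodule k L
  anti : ∀ i j : ℤ, i ≤ j → piece j ≤ piece i
  lie_mem : ∀ i j : ℤ, ∀ a ∈ piece i, ∀ b ∈ piece j, ⁅a, b⁆ ∈ piece (i + j)
  exists_top : ∃ N : ℤ, ∀ i ≤ N, piece i = ⊤
  exists_bot : ∃ N : ℤ, ∀ i ≥ N, piece i = ⊥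

namespace LieAlgFiltration

variable {k L : Type*} [Field k] [LieRing L] [LieAlgebra k L]

/-- The trivial filtration: `F_m = L` for `m ≤ 0` and `F_m = 0` for `m > 0`. -/
def IsTrivial (F : LieAlgFiltration k L) : Prop :=
  (∀ m ≤ 0, F.piece m = ⊤) ∧ (∀ m > 0, F.piece m = ⊥)

/-- `dim (F_m / F_{m+1})`. -/
noncomputable def grDim (F : LieAlgFiltration k L) (m : ℤ) : ℕ :=
  Module.finrank k (F.piece m ⧸ (F.piece (m + 1)).submoduleOf (F.piece m))

/-- Only finitely many graded pieces are non-zero, so the sums below are genuine finite sums. -/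
theorem finite_support_grDim (F : LieAlgFiltration k L) : (Function.support F.grDim).Finite := by
  obtain ⟨a, ha⟩ := F.exists_top
  obtain ⟨b, hb⟩ := F.exists_bot
  refine (Set.finite_Icc a b).subset fun m hm => ?_
  by_contra h
  apply hm
  have key : F.piece m ≤ F.piece (m + 1) := by
    rw [Set.mem_Icc, not_and_or, not_le, not_le] at h
    rcases h with h | h
    · rw [ha (m + 1) (by omega)]; exact le_top
    · rw [hb m (by omega)]; exact bot_le
  have htop : (F.piece (m + 1)).submoduleOf (F.piece m) = ⊤ :=
    Submodule.submoduleOf_eq_top.mpr key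
  unfold grDim
  rw [htop]
  exact Module.finrank_zero_of_subsingleton

/-- `wt(L, F) = ∑_m m · dim (F_m / F_{m+1})`. -/
noncomputable def wt (F : LieAlgFiltration k L) : ℤ :=
  ∑ᶠ m : ℤ, m * (F.grDim m : ℤ)

/-- `‖F‖ = (∑_m m² · dim (F_m / F_{m+1}))^{1/2}`. -/
noncomputable def norm (F : LieAlgFiltration k L) : ℝ :=
  Real.sqrt ((∑ᶠ m : ℤ, m ^ 2 * (F.grDim m : ℤ) : ℤ) : ℝ)

/-- The numerical invariant `ν(L, F) = - wt(L, F) / ‖F‖`. -/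
noncomputable def nu (F : LieAlgFiltration k L) : ℝ :=
  -(F.wt : ℝ) / F.norm

variable (k L) in
/-- `L` is semistable if `- wt(L, F) ≥ 0` for every filtration `F`. -/
def IsSemistable : Prop :=
  ∀ F : LieAlgFiltration k L, 0 ≤ -F.wt

/-- `F` is a canonical filtration of `L`: the trivial filtration if `L` is semistable, a minimizer
of the numerical invariant among all filtrations if `L` is unstable. (In the unstable case the
minimum is negative, so it does not matter that `nu = 0` for the trivial filtration.) -/
def IsCanonical (F : LieAlgFiltration k L) : Prop :=
  (IsSemistable k L ∧ F.IsTrivial) ∨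
    (¬ IsSemistable k L ∧ ∀ G : LieAlgFiltration k L, F.nu ≤ G.nu)

/-- `F` and `G` agree up to positive rescaling of the weights: multiplying all weights of `F` by
some positive integer `p` gives the same filtration as multiplying all weights of `G` by some
positive integer `q`. An element of weight at least `⌈m / p⌉` is one for which `p` times its
weight is at least `m`. -/
def SameUpToScaling (F G : LieAlgFiltration k L) : Prop :=
  ∃ p q : ℕ, 0 < p ∧ 0 < q ∧
    ∀ m : ℤ, F.piece ⌈(m : ℚ) / (p : ℚ)⌉ = G.piece ⌈(m : ℚ) / (q : ℚ)⌉

end LieAlgFiltration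

/-- A Vergne basis `x_0, …, x_n` of a Lie algebra:
`[x_0, x_i] = x_{i+1}` for `1 ≤ i ≤ n - 1`, `[x_1, x_{n-1}] = 0`, and
`[x_i, x_j] ∈ Span(x_{i+j}, …, x_n)` for all `i, j`. -/
structure IsVergneBasis {k L : Type*} [Field k] [LieRing L] [LieAlgebra k L] {n : ℕ}
    (x : Module.Basis (Fin (n + 1)) k L) : Prop where
  lie_zero : ∀ i j : Fin (n + 1), 1 ≤ i.val → j.val = i.val + 1 → ⁅x 0, x i⁆ = x j
  lie_one : ∀ i j : Fin (n + 1), i.val = 1 → j.val + 1 = n → ⁅x i, x j⁆ = 0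
  lie_mem : ∀ i j : Fin (n + 1),
    ⁅x i, x j⁆ ∈ Submodule.span k (x '' {l : Fin (n + 1) | i.val + j.val ≤ l.val})

/-- The underlying space of the model filiform Lie algebra `M_n` of dimension `n + 1`:
coordinate vectors with respect to `x_0, …, x_n`. -/
def ModelFiliform (k : Type*) (n : ℕ) : Type _ := Fin (n + 1) → k

namespace ModelFiliform

variable {k : Type*} [Field k] {n : ℕ}

instance : AddCommGroup (ModelFiliform k n) := inferInstanceAs (AddCommGroup (Fin (n + 1) → k))

instance : Module k (ModelFiliform k n) := inferInstanceAs (Module k (Fin (n + 1) → k))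

/-- The bilinear bracket with `[x_0, x_i] = x_{i+1} = -[x_i, x_0]` for `1 ≤ i ≤ n - 1` and all
other brackets of basis vectors zero, in coordinates. -/
instance : Bracket (ModelFiliform k n) (ModelFiliform k n) where
  bracket u v := fun l : Fin (n + 1) =>
    if 2 ≤ l.val then u 0 * v ⟨l.val - 1, by omega⟩ - v 0 * u ⟨l.val - 1, by omega⟩ else 0

theorem lie_apply (u v : ModelFiliform k n) (l : Fin (n + 1)) :
    ⁅u, v⁆ l = if 2 ≤ l.val then
      u 0 * v ⟨l.val - 1, by omega⟩ - v 0 * u ⟨l.val - 1, by omega⟩ else 0 := rfl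

theorem add_apply (u v : ModelFiliform k n) (l : Fin (n + 1)) : (u + v) l = u l + v l := rfl

theorem smul_apply (c : k) (u : ModelFiliform k n) (l : Fin (n + 1)) :
    (c • u) l = c * u l := rfl

instance : LieRing (ModelFiliform k n) where
  add_lie u v w := by
    funext l
    simp only [lie_apply, add_apply]
    split_ifs <;> ring
  lie_add u v w := by
    funext l
    simp only [lie_apply, add_apply]
    split_ifs <;> ring
  lie_self u := by
    funext l
    change ⁅u, u⁆ l = 0
    rw [lie_apply]
    split_ifs <;> ring
  leibniz_lie u v w := by
    funext l
    have h0 : ¬ (2 ≤ 0) := by omega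
    simp only [add_apply, lie_apply, Fin.val_zero, h0, if_false]
    split_ifs <;> ring

instance : LieAlgebra k (ModelFiliform k n) where
  lie_smul c u v := by
    funext l
    simp only [lie_apply, smul_apply]
    split_ifs <;> ring

end ModelFiliform

/-! Any filtration `G` induces a filtration on the one-dimensional quotients of the flag of tails of
a Vergne basis; let `g i` be the weight on the quotient of index `i`. Then wt is the sum of the `g
i` and the squared norm is the sum of their squares, so `nu` depends on `g` alone. Bracketing
leading terms gives `g 0 + g i ≤ g (i + 1)` for `1 ≤ i < n`.

On this cone Kuhn–Tucker multipliers `6 i (n - i)` give `D * ∑ g ≤ ⟨w, g⟩` with `D = n ^ 3 - n +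
12`, and equality holds for `g = w` (`kuhnTucker_identity`). By Cauchy–Schwarz `∑ g / |g|` is
largest at `w`, and a maximizer is proportional to `w` (`proportional_of_sq_le`). Since `w` is
monotone, the weights then determine the filtration itself: its pivot sets are closed upwards, which
forces each piece to be spanned by basis vectors (`eq_span_of_isPivot_iff`). -/

open Module

/-! ### Pivots of a subspace with respect to an ordered basis. -/

section Pivot

variable {k L : Type*} [Field k] [AddCommGroup L] [Module k L] {N : ℕ}

/-- `i` is a pivot of the subspace `W` with respect to the basis `x` if `W` contains a vector
whose first non-zero coordinate has index `i`. -/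
def IsPivot (x : Basis (Fin N) k L) (W : Submodule k L) (i : Fin N) : Prop :=
  ∃ u ∈ W, (∀ j < i, x.repr u j = 0) ∧ x.repr u i ≠ 0

/-- The vectors whose coordinates of index less than `c` vanish. -/
def tailSpan (x : Basis (Fin N) k L) (c : ℕ) : Submodule k L where
  carrier := {u | ∀ j : Fin N, j.val < c → x.repr u j = 0}
  add_mem' hu hv j hj := by simp [hu j hj, hv j hj]
  zero_mem' j _ := by simp
  smul_mem' a u hu j hj := by simp [hu j hj]

theorem mem_tailSpan {x : Basis (Fin N) k L} {c : ℕ} {u : L} :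
    u ∈ tailSpan x c ↔ ∀ j : Fin N, j.val < c → x.repr u j = 0 := Iff.rfl

/-- Intersecting with the kernel of a linear form that does not vanish on a subspace lowers its
dimension by one. -/
theorem finrank_inf_ker_add_one [FiniteDimensional k L] (W : Submodule k L) (f : L →ₗ[k] k)
    {u : L} (hu : u ∈ W) (hf : f u ≠ 0) :
    finrank k (W ⊓ LinearMap.ker f : Submodule k L) + 1 = finrank k W := by
  have h1 := (f.domRestrict W).finrank_range_add_finrank_ker
  have h2 : LinearMap.range (f.domRestrict W) = ⊤ :=
    LinearMap.range_eq_top.mpr (LinearMap.surjective (by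
      intro h
      exact hf (by simpa using LinearMap.congr_fun h (⟨u, hu⟩ : W))))
  have h3 : finrank k (LinearMap.ker (f.domRestrict W)) =
      finrank k (W ⊓ LinearMap.ker f : Submodule k L) := by
    rw [LinearEquiv.finrank_eq
      (Submodule.equivMapOfInjective W.subtype W.injective_subtype
        (LinearMap.ker (f.domRestrict W)))]
    have h : (LinearMap.ker (f.domRestrict W)).map W.subtype = W ⊓ LinearMap.ker f := by
      ext v
      simp [and_comm]
    rw [h]
  rw [h2, finrank_top, finrank_self, h3] at h1
  omega

-- Descending induction on `c`: passing from `c` to `c + 1` imposes one more linear condition, which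
-- lowers the dimension by one exactly when `c` is a pivot of `W`.
open Classical in
theorem finrank_inf_tailSpan (x : Basis (Fin N) k L) (W : Submodule k L) (c : ℕ) (hc : c ≤ N) :
    finrank k (W ⊓ tailSpan x c : Submodule k L) =
      (Finset.univ.filter fun i : Fin N => c ≤ i.val ∧ IsPivot x W i).card := by
  have : FiniteDimensional k L := x.finiteDimensional_of_finite
  induction hc using Nat.decreasingInduction with
  | self =>
    have h : W ⊓ tailSpan x N = ⊥ := by
      refine (Submodule.eq_bot_iff _).mpr fun u hu => ?_
      exact x.ext_elem fun i => by simpa using hu.2 i i.isLt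
    rw [h, finrank_bot, eq_comm, Finset.card_eq_zero, Finset.filter_eq_empty_iff]
    rintro i - ⟨h1, -⟩
    have := i.isLt
    omega
  | of_succ c hc ih =>
    set i : Fin N := ⟨c, hc⟩ with hi
    have hker : W ⊓ tailSpan x (c + 1) = (W ⊓ tailSpan x c) ⊓ LinearMap.ker (x.coord i) := by
      ext u
      simp only [Submodule.mem_inf, mem_tailSpan, LinearMap.mem_ker, Basis.coord_apply, and_assoc]
      refine and_congr_right fun _ => ⟨fun h => ⟨fun j hj => h j (by omega), h i (by simp [hi])⟩,
        fun h j hj => ?_⟩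
      rcases Nat.lt_succ_iff_lt_or_eq.mp hj with h' | h'
      · exact h.1 j h'
      · rw [show j = i from Fin.ext h']
        exact h.2
    by_cases hp : IsPivot x W i
    · obtain ⟨u, hu, hu0, hu1⟩ := id hp
      rw [← finrank_inf_ker_add_one (W ⊓ tailSpan x c) (x.coord i) (u := u)
        ⟨hu, fun j hj => hu0 j hj⟩ hu1, ← hker, ih,
        ← Finset.card_insert_of_notMem (a := i) (by simp [hi])]
      congr 1
      ext j
      simp only [Finset.mem_insert, Finset.mem_filter, Finset.mem_univ, true_and]
      constructor
      · rintro (rfl | h)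
        · exact ⟨le_rfl, hp⟩
        · exact ⟨by omega, h.2⟩
      · rintro ⟨h1, h2⟩
        by_cases hj : j.val = c
        · exact Or.inl (Fin.ext hj)
        · exact Or.inr ⟨by omega, h2⟩
    · have hle : W ⊓ tailSpan x c ≤ LinearMap.ker (x.coord i) := by
        intro u hu
        by_contra h
        exact hp ⟨u, hu.1, fun j hj => hu.2 j hj, h⟩
      rw [inf_eq_left.mpr hle] at hker
      rw [← hker, ih]
      congr 1
      ext j
      simp only [Finset.mem_filter, Finset.mem_univ, true_and]
      refine ⟨fun h => ⟨by omega, h.2⟩, fun h => ⟨?_, h.2⟩⟩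
      by_contra hj
      exact hp ((show j = i from Fin.ext (by simp only [hi]; omega)) ▸ h.2)

open Classical in
/-- The dimension of a subspace is the number of its pivots. -/
theorem finrank_eq_card_pivots (x : Basis (Fin N) k L) (W : Submodule k L) :
    finrank k W = (Finset.univ.filter fun i : Fin N => IsPivot x W i).card := by
  have h := finrank_inf_tailSpan x W 0 (Nat.zero_le N)
  have h0 : tailSpan x 0 = ⊤ := by
    refine eq_top_iff.mpr fun u _ => ?_
    intro j hj
    omega
  rw [h0, inf_top_eq] at h
  simpa using h

theorem IsPivot.mono {x : Basis (Fin N) k L} {W W' : Submodule k L} (h : W ≤ W') {i : Fin N}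
    (hi : IsPivot x W i) : IsPivot x W' i := by
  obtain ⟨u, hu, h'⟩ := hi
  exact ⟨u, h hu, h'⟩

theorem eq_of_le_of_isPivot {x : Basis (Fin N) k L} {W W' : Submodule k L} (h : W ≤ W')
    (hp : ∀ i, IsPivot x W' i → IsPivot x W i) : W = W' := by
  classical
  have : FiniteDimensional k L := x.finiteDimensional_of_finite
  refine Submodule.eq_of_le_of_finrank_eq h ?_
  rw [finrank_eq_card_pivots x, finrank_eq_card_pivots x]
  congr 1
  ext i
  simpa using ⟨fun hi => hi.mono h, hp i⟩

theorem mem_span_basis_image {x : Basis (Fin N) k L} {T : Set (Fin N)} {u : L} :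
    u ∈ Submodule.span k (x '' T) ↔ ∀ i, x.repr u i ≠ 0 → i ∈ T := by
  rw [Basis.mem_span_image]
  simp [Set.subset_def]

theorem isPivot_span_iff {x : Basis (Fin N) k L} {T : Set (Fin N)} {i : Fin N} :
    IsPivot x (Submodule.span k (x '' T)) i ↔ i ∈ T := by
  constructor
  · rintro ⟨u, hu, -, h⟩
    exact mem_span_basis_image.mp hu i h
  · intro h
    refine ⟨x i, Submodule.subset_span ⟨i, h, rfl⟩, fun j hj => ?_, by simp⟩
    simp [hj.ne']

/-- A subspace whose set of pivots is closed upwards is spanned by basis vectors. -/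
theorem eq_span_of_isPivot_iff {x : Basis (Fin N) k L} {W : Submodule k L} {T : Set (Fin N)}
    (hT : ∀ i ∈ T, ∀ j, i ≤ j → j ∈ T) (hW : ∀ i, IsPivot x W i ↔ i ∈ T) :
    W = Submodule.span k (x '' T) := by
  -- A vector with leading index `i` only involves indices `≥ i`, all of which lie in `T`. So the
  -- intersection has the same pivots as both subspaces, hence equals both.
  have key : ∀ i ∈ T, IsPivot x (W ⊓ Submodule.span k (x '' T)) i := by
    intro i hi
    obtain ⟨u, hu, h0, h1⟩ := (hW i).mpr hi
    refine ⟨u, ⟨hu, mem_span_basis_image.mpr fun j hj => hT i hi j ?_⟩, h0, h1⟩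
    by_contra h
    exact hj (h0 j (not_le.mp h))
  rw [← eq_of_le_of_isPivot (x := x) inf_le_left fun i hi => key i ((hW i).mp hi)]
  exact eq_of_le_of_isPivot (x := x) inf_le_right fun i hi => key i (isPivot_span_iff.mp hi)

theorem isPivot_top (x : Basis (Fin N) k L) (i : Fin N) : IsPivot x ⊤ i :=
  ⟨x i, trivial, fun j hj => by simp [hj.ne'], by simp⟩

theorem not_isPivot_bot (x : Basis (Fin N) k L) (i : Fin N) : ¬ IsPivot x ⊥ i := by
  rintro ⟨u, hu, -, h⟩
  rw [Submodule.mem_bot] at hu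
  simp [hu] at h

end Pivot

/-! ### Weights of a filtration along a flag. -/

namespace LieAlgFiltration

variable {k L : Type*} [Field k] [LieRing L] [LieAlgebra k L] {N : ℕ}

/-- `g` lists the weights of the filtration induced by `F` on the successive quotients of the flag
of the basis `x`. -/
def HasFlagWeights (F : LieAlgFiltration k L) (x : Basis (Fin N) k L) (g : Fin N → ℤ) : Prop :=
  ∀ m i, IsPivot x (F.piece m) i ↔ m ≤ g i

theorem exists_hasFlagWeights (F : LieAlgFiltration k L) (x : Basis (Fin N) k L) :
    ∃ g : Fin N → ℤ, F.HasFlagWeights x g := by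
  have h : ∀ i, ∃ a : ℤ, ∀ m, IsPivot x (F.piece m) i ↔ m ≤ a := by
    intro i
    obtain ⟨a, ha⟩ := F.exists_top
    obtain ⟨b, hb⟩ := F.exists_bot
    obtain ⟨c, hc, hmax⟩ := Int.exists_greatest_of_bdd
      (P := fun m => IsPivot x (F.piece m) i)
      ⟨b, fun m hm => by
        by_contra h
        rw [hb m (by omega)] at hm
        exact not_isPivot_bot x i hm⟩
      ⟨a, by rw [ha a le_rfl]; exact isPivot_top x i⟩
    exact ⟨c, fun m => ⟨hmax m, fun h => hc.mono (F.anti m c h)⟩⟩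
  choose g hg using h
  exact ⟨g, fun m i => hg i m⟩

variable {F : LieAlgFiltration k L} {x : Basis (Fin N) k L} {g : Fin N → ℤ}

/-- The pivots of `F_m` are the `i` with `m ≤ g i`, so those lost in passing to `F_{m+1}` are the
`i` with `g i = m`. -/
theorem HasFlagWeights.grDim_eq (h : F.HasFlagWeights x g) (m : ℤ) :
    F.grDim m = (Finset.univ.filter fun i => g i = m).card := by
  classical
  have : FiniteDimensional k L := x.finiteDimensional_of_finite
  have h1 := Submodule.finrank_quotient_add_finrank
    ((F.piece (m + 1)).submoduleOf (F.piece m))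
  rw [(Submodule.submoduleOfEquivOfLe (F.anti m (m + 1) (by omega))).finrank_eq,
    finrank_eq_card_pivots x, finrank_eq_card_pivots x] at h1
  simp only [h _ _] at h1
  have h2 : (Finset.univ.filter fun i => m ≤ g i) =
      (Finset.univ.filter fun i => g i = m) ∪ (Finset.univ.filter fun i => m + 1 ≤ g i) := by
    ext i
    simp only [Finset.mem_union, Finset.mem_filter, Finset.mem_univ, true_and]
    omega
  rw [h2, Finset.card_union_of_disjoint (Finset.disjoint_filter.mpr (by intros; omega))] at h1
  unfold grDim
  omega

theorem HasFlagWeights.finsum_eq (h : F.HasFlagWeights x g) (f : ℤ → ℤ) :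
    ∑ᶠ m : ℤ, f m * (F.grDim m : ℤ) = ∑ i, f (g i) := by
  classical
  rw [finsum_eq_sum_of_support_subset (s := Finset.univ.image g), Finset.sum_comp f g]
  · refine Finset.sum_congr rfl fun m _ => ?_
    rw [h.grDim_eq, nsmul_eq_mul, mul_comm]
  · intro m hm
    have h0 : F.grDim m ≠ 0 := by
      rintro h0
      simp [h0] at hm
    rw [h.grDim_eq, Finset.card_ne_zero] at h0
    obtain ⟨i, hi⟩ := h0
    simp only [Finset.mem_filter] at hi
    simp only [Finset.coe_image, Finset.coe_univ, Set.image_univ]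
    exact ⟨i, hi.2⟩

theorem HasFlagWeights.wt_eq (h : F.HasFlagWeights x g) : F.wt = ∑ i, g i :=
  h.finsum_eq fun m => m

theorem HasFlagWeights.norm_eq (h : F.HasFlagWeights x g) :
    F.norm = Real.sqrt ((∑ i, g i ^ 2 : ℤ) : ℝ) := by
  rw [norm, h.finsum_eq fun m => m ^ 2]

theorem HasFlagWeights.nu_eq (h : F.HasFlagWeights x g) :
    F.nu = -((∑ i, g i : ℤ) : ℝ) / Real.sqrt ((∑ i, g i ^ 2 : ℤ) : ℝ) := by
  rw [nu, h.wt_eq, h.norm_eq]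

theorem ceil_div_le_iff {m a : ℤ} {p : ℕ} (hp : 0 < p) :
    ⌈(m : ℚ) / (p : ℚ)⌉ ≤ a ↔ m ≤ p * a := by
  rw [Int.ceil_le, div_le_iff₀ (by exact_mod_cast hp), mul_comm]
  exact_mod_cast Iff.rfl

/-- Filtrations that agree up to scaling have proportional flag weights. -/
theorem SameUpToScaling.flagWeights {G : LieAlgFiltration k L} {w : Fin N → ℤ}
    (hG : G.HasFlagWeights x g) (hF : F.HasFlagWeights x w) (h : G.SameUpToScaling F) :
    ∃ p q : ℕ, 0 < p ∧ 0 < q ∧ ∀ i, (p : ℤ) * g i = q * w i := by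
  obtain ⟨p, q, hp, hq, hm⟩ := h
  refine ⟨p, q, hp, hq, fun i => ?_⟩
  have key : ∀ m : ℤ, m ≤ p * g i ↔ m ≤ q * w i := fun m => by
    rw [← ceil_div_le_iff hp, ← ceil_div_le_iff hq, ← hG, ← hF, hm]
  exact le_antisymm ((key _).mp le_rfl) ((key _).mpr le_rfl)

/-- Filtrations with proportional monotone flag weights agree up to scaling. -/
theorem HasFlagWeights.sameUpToScaling {G : LieAlgFiltration k L} {w : Fin N → ℤ}
    (hG : G.HasFlagWeights x g) (hF : F.HasFlagWeights x w) (hw : Monotone w) {p q : ℕ}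
    (hp : 0 < p) (hq : 0 < q) (h : ∀ i, (p : ℤ) * g i = q * w i) : G.SameUpToScaling F := by
  refine ⟨p, q, hp, hq, fun m => ?_⟩
  -- Monotonicity of `w` closes the common pivot set upwards, so both pieces must be the same span
  -- of basis vectors.
  have hT : ∀ i ∈ {i | m ≤ q * w i}, ∀ j, i ≤ j → j ∈ {i | m ≤ q * w i} := fun i hi j hij =>
    le_trans hi (mul_le_mul_of_nonneg_left (hw hij) (by positivity))
  refine (eq_span_of_isPivot_iff (x := x) hT fun i => ?_).trans
    (eq_span_of_isPivot_iff (x := x) hT fun i => ?_).symm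
  · rw [hG, ceil_div_le_iff hp, h, Set.mem_ofPred_eq]
  · rw [hF, ceil_div_le_iff hq, Set.mem_ofPred_eq]

/-- Filtrations with proportional flag weights have the same numerical invariant. -/
theorem HasFlagWeights.nu_eq_of_proportional {G : LieAlgFiltration k L} {w : Fin N → ℤ}
    (hG : G.HasFlagWeights x g) (hF : F.HasFlagWeights x w) {p q : ℕ}
    (hp : 0 < p) (hq : 0 < q) (h : ∀ i, (p : ℤ) * g i = q * w i) : G.nu = F.nu := by
  have hp' : (0 : ℝ) < p := by exact_mod_cast hp
  have hq' : (0 : ℝ) < q := by exact_mod_cast hq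
  have scale : ∀ (a : ℕ), (0 : ℝ) < a → ∀ v : Fin N → ℤ,
      -((∑ i, v i : ℤ) : ℝ) / Real.sqrt ((∑ i, v i ^ 2 : ℤ) : ℝ) =
        -((∑ i, (a : ℤ) * v i : ℤ) : ℝ) /
          Real.sqrt ((∑ i, ((a : ℤ) * v i) ^ 2 : ℤ) : ℝ) := by
    intro a ha v
    simp only [mul_pow, ← Finset.mul_sum]
    push_cast
    rw [Real.sqrt_mul (by positivity), Real.sqrt_sq ha.le, ← mul_neg,
      mul_div_mul_left _ _ ha.ne']
  rw [hG.nu_eq, hF.nu_eq, scale p hp' g, scale q hq' w]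
  simp only [h]

end LieAlgFiltration

/-! ### Vergne bases of the model filiform algebra. -/

namespace IsVergneBasis

variable {k : Type*} [Field k] {n : ℕ} {x : Basis (Fin (n + 1)) k (ModelFiliform k n)}

theorem apply_eq_zero (hx : IsVergneBasis x) (i : Fin (n + 1)) (hi : 2 ≤ i.val)
    (l : Fin (n + 1)) (hl : l < i) : x i l = 0 := by
  obtain ⟨i, hi'⟩ := i
  change 2 ≤ i at hi
  induction i, hi using Nat.le_induction generalizing l with
  | base =>
    rw [← hx.lie_zero ⟨1, by omega⟩ ⟨2, hi'⟩ le_rfl rfl, ModelFiliform.lie_apply,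
      if_neg (by rw [Fin.lt_def] at hl; exact not_le.mpr hl)]
  | succ i hi ih =>
    rw [← hx.lie_zero ⟨i, by omega⟩ ⟨i + 1, hi'⟩ (by simp only; omega) rfl,
      ModelFiliform.lie_apply]
    rw [Fin.lt_def] at hl
    simp only at hl
    split_ifs with h
    · rw [ih 0 (by omega) (by rw [Fin.lt_def]; simp only [Fin.val_zero]; omega),
        ih _ (by omega) (by rw [Fin.lt_def]; simp only; omega)]
      ring
    · rfl

/-- For `i = 1` this rests on `[x_1, x_{n-1}] = 0`: as `n - 1 ≥ 2`, the last coordinate of that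
bracket is the 0-th coordinate of `x_1` times the `(n-1)`-st of `x_{n-1}`, and the latter is
non-zero because `[x_0, x_{n-1}] = x_n ≠ 0`. -/
theorem apply_zero (hx : IsVergneBasis x) (hn : 3 ≤ n) (i : Fin (n + 1)) (hi : 1 ≤ i.val) :
    x i 0 = 0 := by
  by_cases h2 : 2 ≤ i.val
  · exact hx.apply_eq_zero i h2 0 (by rw [Fin.lt_def]; simp only [Fin.val_zero]; omega)
  have hi1 : i.val = 1 := by omega
  set j : Fin (n + 1) := ⟨n - 1, by omega⟩ with hj
  have hj0 : x j 0 = 0 := hx.apply_eq_zero j (by simp only [hj]; omega) 0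
    (by rw [Fin.lt_def]; simp only [Fin.val_zero, hj]; omega)
  have hlast : x (Fin.last n) (Fin.last n) ≠ 0 := by
    intro h
    refine x.ne_zero (Fin.last n) (funext fun l => ?_)
    rcases (Fin.le_last l).lt_or_eq with h' | h'
    · exact hx.apply_eq_zero _ (by simp only [Fin.val_last]; omega) l h'
    · rw [h']
      exact h
  have hne : x j j ≠ 0 := by
    intro h
    apply hlast
    conv_lhs => rw [← hx.lie_zero j (Fin.last n) (by simp only [hj]; omega)
      (by simp only [hj, Fin.val_last]; omega)]
    rw [ModelFiliform.lie_apply, if_pos (by simp only [Fin.val_last]; omega)]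
    change x 0 0 * x j j - x j 0 * _ = 0
    rw [h, hj0]
    ring
  have h1 : ⁅x i, x j⁆ (Fin.last n) = 0 := by
    rw [hx.lie_one i j hi1 (by simp only [hj]; omega)]
    rfl
  rw [ModelFiliform.lie_apply, if_pos (by simp only [Fin.val_last]; omega)] at h1
  change x i 0 * x j j - x j 0 * _ = 0 at h1
  rw [hj0, zero_mul, sub_zero] at h1
  exact (mul_eq_zero.mp h1).resolve_right hne

/-- For `n ≥ 3` both vectors lie in the abelian ideal where coordinate 0 vanishes. For `n ≤ 2`
distinct positive indices add up to more than `n`, so the span in `lie_mem` is zero. -/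
theorem lie_eq_zero (hx : IsVergneBasis x) (i j : Fin (n + 1)) (hi : 1 ≤ i.val)
    (hj : 1 ≤ j.val) : ⁅x i, x j⁆ = 0 := by
  by_cases hn : 3 ≤ n
  · funext l
    change ⁅x i, x j⁆ l = 0
    rw [ModelFiliform.lie_apply, hx.apply_zero hn i hi, hx.apply_zero hn j hj]
    split_ifs
    · ring
    · rfl
  · by_cases hij : i = j
    · rw [hij, lie_self]
    · have h := hx.lie_mem i j
      have hne : i.val ≠ j.val := fun h' => hij (Fin.ext h')
      have : {l : Fin (n + 1) | i.val + j.val ≤ l.val} = ∅ := by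
        ext l
        simp only [Set.mem_ofPred_eq, Set.mem_empty_iff_false, iff_false]
        omega
      simpa [this] using h

theorem lie_last (hx : IsVergneBasis x) (hn : 1 ≤ n) : ⁅x 0, x (Fin.last n)⁆ = 0 := by
  funext l
  change ⁅x 0, x (Fin.last n)⁆ l = 0
  rw [ModelFiliform.lie_apply]
  split_ifs with h
  · have hl := l.isLt
    rw [hx.apply_eq_zero (Fin.last n) (by simp only [Fin.val_last]; omega) 0
        (by rw [Fin.lt_def]; simp only [Fin.val_zero, Fin.val_last]; omega),
      hx.apply_eq_zero (Fin.last n) (by simp only [Fin.val_last]; omega) _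
        (by rw [Fin.lt_def]; simp only [Fin.val_last]; omega)]
    ring
  · rfl

/-- The structure constants of the model filiform Lie algebra are the same in every Vergne
basis. -/
theorem repr_lie (hx : IsVergneBasis x) (hn : 1 ≤ n) (u v : ModelFiliform k n)
    (l : Fin (n + 1)) :
    x.repr ⁅u, v⁆ l = if 2 ≤ l.val then
      x.repr u 0 * x.repr v ⟨l.val - 1, by omega⟩ -
        x.repr v 0 * x.repr u ⟨l.val - 1, by omega⟩ else 0 := by
  let A : ModelFiliform k n →ₗ[k] ModelFiliform k n →ₗ[k] k :=
    LinearMap.mk₂ k (fun u v => x.repr ⁅u, v⁆ l) (by simp) (by simp) (by simp) (by simp)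
  let B : ModelFiliform k n →ₗ[k] ModelFiliform k n →ₗ[k] k :=
    LinearMap.mk₂ k (fun u v => if 2 ≤ l.val then
      x.repr u 0 * x.repr v ⟨l.val - 1, by omega⟩ -
        x.repr v 0 * x.repr u ⟨l.val - 1, by omega⟩ else 0)
      (by intros; split_ifs <;> simp; ring) (by intros; split_ifs <;> simp; ring)
      (by intros; split_ifs <;> simp; ring) (by intros; split_ifs <;> simp; ring)
  have pos : ∀ j : Fin (n + 1), ⁅x 0, x j⁆ = 0 ∧ (j.val = 0 ∨ j.val = n) ∨
      1 ≤ j.val ∧ ∃ h : j.val + 1 < n + 1, ⁅x 0, x j⁆ = x ⟨j.val + 1, h⟩ := by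
    intro j
    by_cases h0 : j.val = 0
    · rw [show j = 0 from Fin.ext h0]
      exact Or.inl ⟨lie_self _, Or.inl rfl⟩
    by_cases h1 : j.val = n
    · rw [show j = Fin.last n from Fin.ext h1]
      exact Or.inl ⟨hx.lie_last hn, Or.inr rfl⟩
    · exact Or.inr ⟨by omega, by omega, hx.lie_zero j _ (by omega) rfl⟩
  have zeroCase : ∀ j, A (x 0) (x j) = B (x 0) (x j) := by
    intro j
    change x.repr ⁅x 0, x j⁆ l = if 2 ≤ l.val then
      x.repr (x 0) 0 * x.repr (x j) ⟨l.val - 1, by omega⟩ -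
        x.repr (x j) 0 * x.repr (x 0) ⟨l.val - 1, by omega⟩ else 0
    have hl := l.isLt
    rcases pos j with ⟨h, hj⟩ | ⟨hj, h1, h⟩
    · rw [h]
      simp only [map_zero, Finsupp.coe_zero, Pi.zero_apply, Basis.repr_self,
        Finsupp.single_apply, Fin.ext_iff, Fin.val_zero]
      split_ifs <;> first | omega | simp
    · rw [h]
      simp only [Basis.repr_self, Finsupp.single_apply, Fin.ext_iff, Fin.val_zero]
      split_ifs <;> first | omega | simp
  have hAB : A = B := by
    refine x.ext fun i => x.ext fun j => ?_
    by_cases hi : i.val = 0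
    · rw [show i = 0 from Fin.ext hi]
      exact zeroCase j
    by_cases hj : j.val = 0
    · rw [show j = 0 from Fin.ext hj]
      have hA : A (x i) (x 0) = -A (x 0) (x i) := by
        change x.repr ⁅x i, x 0⁆ l = -x.repr ⁅x 0, x i⁆ l
        rw [← lie_skew, map_neg, Finsupp.neg_apply]
      have hB : B (x i) (x 0) = -B (x 0) (x i) := by
        simp only [B, LinearMap.mk₂_apply]
        split_ifs <;> ring
      rw [hA, hB, zeroCase]
    · simp only [A, B, LinearMap.mk₂_apply]
      rw [hx.lie_eq_zero i j (by omega) (by omega)]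
      simp [Finsupp.single_apply, Fin.ext_iff, hi, hj]
  exact LinearMap.congr_fun₂ hAB u v

/-- The flag weights of a filtration satisfy the inequalities coming from `[x_0, x_i] = x_{i+1}`. -/
theorem flagWeights_add_le (hx : IsVergneBasis x) (hn : 1 ≤ n)
    {G : LieAlgFiltration k (ModelFiliform k n)} {g : Fin (n + 1) → ℤ}
    (hG : G.HasFlagWeights x g) (i j : Fin (n + 1)) (hi : 1 ≤ i.val) (hj : j.val = i.val + 1) :
    g 0 + g i ≤ g j := by
  -- With leading indices 0 and `i ≥ 1`, the bracket of `u` and `v` has leading index `i + 1`, with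
  -- coefficient the product of the two leading coefficients.
  obtain ⟨u, hu, -, hu1⟩ := (hG (g 0) 0).mpr le_rfl
  obtain ⟨v, hv, hv0, hv1⟩ := (hG (g i) i).mpr le_rfl
  have hv00 : x.repr v 0 = 0 := hv0 0 hi
  refine (hG _ j).mp ⟨⁅u, v⁆, G.lie_mem _ _ u hu v hv, fun l hl => ?_, ?_⟩
  · rw [hx.repr_lie hn, hv00]
    rw [Fin.lt_def] at hl
    split_ifs with h
    · rw [hv0 _ (by rw [Fin.lt_def]; simp only; omega)]
      ring
    · rfl
  · rw [hx.repr_lie hn, hv00, if_pos (by omega),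
      show (⟨j.val - 1, by omega⟩ : Fin (n + 1)) = i from Fin.ext (by simp [hj])]
    simpa using ⟨hu1, hv1⟩

/-- The filtration spanned by the vectors of a Vergne basis, for weights compatible with the
brackets `[x_0, x_i] = x_{i+1}`. -/
def filtration (hx : IsVergneBasis x) (hn : 1 ≤ n) (w : Fin (n + 1) → ℤ)
    (hw : ∀ i j : Fin (n + 1), 1 ≤ i.val → j.val = i.val + 1 → w 0 + w i ≤ w j) :
    LieAlgFiltration k (ModelFiliform k n) where
  piece m := Submodule.span k (x '' {i | m ≤ w i})
  anti i j hij := Submodule.span_mono (Set.image_mono fun _ h => le_trans hij h)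
  lie_mem a b u hu v hv := by
    rw [mem_span_basis_image] at *
    intro l hl
    rw [hx.repr_lie hn] at hl
    simp only [Set.mem_ofPred_eq] at *
    split_ifs at hl with h2
    · have hl' := hw ⟨l.val - 1, by omega⟩ l (by simp only; omega) (by simp only; omega)
      by_cases h : x.repr u 0 * x.repr v ⟨l.val - 1, by omega⟩ = 0
      · rw [h, zero_sub, neg_ne_zero] at hl
        have h1 := hv _ (left_ne_zero_of_mul hl)
        have h2 := hu _ (right_ne_zero_of_mul hl)
        omega
      · have h1 := hu _ (left_ne_zero_of_mul h)
        have h2 := hv _ (right_ne_zero_of_mul h)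
        omega
    · exact absurd rfl hl
  exists_top := by
    obtain ⟨a, ha⟩ := (Set.finite_range w).bddBelow
    refine ⟨a, fun m hm => ?_⟩
    rw [show {i | m ≤ w i} = Set.univ from
      Set.eq_univ_of_forall fun i => le_trans hm (ha ⟨i, rfl⟩), Set.image_univ, x.span_eq]
  exists_bot := by
    obtain ⟨b, hb⟩ := (Set.finite_range w).bddAbove
    refine ⟨b + 1, fun m hm => ?_⟩
    rw [show {i | m ≤ w i} = ∅ from Set.eq_empty_of_forall_notMem fun i hi => by
      have h1 := hb ⟨i, rfl⟩
      have h2 : m ≤ w i := hi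
      omega]
    simp

end IsVergneBasis

/-! ### Maximizing the normalized sum of weights. -/

section Optimization

/-- Summation by parts for the multipliers `6 i (N - i)`. At `m = N` the boundary term vanishes and
the coefficient of `g 0` becomes `N ^ 3 - N`. -/
theorem sum_range_multipliers (N : ℤ) (g : ℕ → ℤ) (m : ℕ) :
    ∑ i ∈ Finset.range m, 6 * i * (N - i) * (g 0 + g i - g (i + 1)) =
      g 0 * (3 * N * m * (m - 1) - m * (m - 1) * (2 * m - 1)) +
        ∑ i ∈ Finset.range m, (6 * N - 6 - 12 * i) * g (i + 1) - 6 * m * (N - m) * g m := by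
  induction m with
  | zero => simp
  | succ m ih =>
    rw [Finset.sum_range_succ, Finset.sum_range_succ, ih]
    push_cast
    ring

variable {n : ℕ} {w : Fin (n + 1) → ℤ}

/-- The Kuhn–Tucker identity for maximizing the sum of the weights under the constraints
`g 0 + g i ≤ g (i + 1)`. -/
theorem kuhnTucker_identity (hw0 : w 0 = 12)
    (hw : ∀ i : Fin (n + 1), 1 ≤ i.val →
      w i = (n : ℤ) ^ 3 - 7 * (n : ℤ) + 18 + 12 * ((i.val : ℤ) - 1)) (g : Fin (n + 1) → ℤ) :
    ((n : ℤ) ^ 3 - n + 12) * ∑ i, g i = ∑ i, w i * g i +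
      ∑ i : Fin n, 6 * (i.val : ℤ) * (n - i.val) * (g 0 + g i.castSucc - g i.succ) := by
  set f : ℕ → ℤ := fun i => if h : i < n + 1 then g ⟨i, h⟩ else 0 with hf
  have hfg : ∀ i : Fin (n + 1), f i.val = g i := fun i => dif_pos i.isLt
  have h0 : f 0 = g 0 := hfg 0
  have key := sum_range_multipliers n f n
  rw [← Fin.sum_univ_eq_sum_range
      (fun i => 6 * (i : ℤ) * ((n : ℤ) - i) * (f 0 + f i - f (i + 1))),
    ← Fin.sum_univ_eq_sum_range (fun i => (6 * (n : ℤ) - 6 - 12 * i) * f (i + 1))] at key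
  have e1 : ∀ i : Fin n, f i.val = g i.castSucc := fun i => hfg i.castSucc
  have e2 : ∀ i : Fin n, f (i.val + 1) = g i.succ := fun i => hfg i.succ
  simp only [e1, e2, h0] at key
  rw [key, Fin.sum_univ_succ, Fin.sum_univ_succ, hw0, mul_add, Finset.mul_sum]
  have h3 : ∀ i : Fin n, w i.succ * g i.succ + (6 * (n : ℤ) - 6 - 12 * i.val) * g i.succ =
      ((n : ℤ) ^ 3 - n + 12) * g i.succ := fun i => by
    rw [hw i.succ (by simp)]
    simp only [Fin.val_succ]
    push_cast
    ring
  simp only [← h3, Finset.sum_add_distrib]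
  ring

/-- Weights with positive sum whose normalized sum is at least that of `w` are
proportional to `w`. -/
theorem proportional_of_sq_le {ι : Type*} [Fintype ι] {w g : ι → ℤ} {D : ℤ} (hD : 0 < D)
    (hS : 0 < ∑ i, g i) (hQ : D * ∑ i, w i = ∑ i, w i ^ 2) (hW : 0 < ∑ i, w i)
    (hB : D * ∑ i, g i ≤ ∑ i, w i * g i)
    (hle : (∑ i, w i) ^ 2 * ∑ i, g i ^ 2 ≤ (∑ i, g i) ^ 2 * ∑ i, w i ^ 2) (i : ι) :
    (∑ i, w i ^ 2) * g i = (∑ i, w i * g i) * w i := by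
  set S := ∑ i, g i
  set W := ∑ i, w i
  set Q := ∑ i, w i ^ 2 with hQdef
  set B := ∑ i, w i * g i with hBdef
  set P := ∑ i, g i ^ 2 with hPdef
  have hQ0 : 0 < Q := hQ ▸ mul_pos hD hW
  have hB0 : 0 < B := lt_of_lt_of_le (mul_pos hD hS) hB
  -- This is the reverse of Cauchy–Schwarz, hence the equality case.
  have h1 : P * Q ≤ B ^ 2 := by
    have h2 : (D * S) ^ 2 ≤ B ^ 2 := pow_le_pow_left₀ (mul_pos hD hS).le hB 2
    have h3 : W ^ 2 * (P * Q) ≤ W ^ 2 * B ^ 2 := by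
      calc W ^ 2 * (P * Q) = W ^ 2 * P * Q := by ring
        _ ≤ S ^ 2 * Q * Q := mul_le_mul_of_nonneg_right hle hQ0.le
        _ = W ^ 2 * (D * S) ^ 2 := by rw [← hQ]; ring
        _ ≤ W ^ 2 * B ^ 2 := mul_le_mul_of_nonneg_left h2 (sq_nonneg W)
    exact le_of_mul_le_mul_left h3 (pow_pos hW 2)
  have h2 : ∑ j, (Q * g j - B * w j) ^ 2 = Q * (P * Q - B ^ 2) := by
    have : ∀ j, (Q * g j - B * w j) ^ 2 =
        Q ^ 2 * g j ^ 2 - 2 * Q * B * (w j * g j) + B ^ 2 * w j ^ 2 := fun j => by ring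
    simp only [this, Finset.sum_add_distrib, Finset.sum_sub_distrib, ← Finset.mul_sum]
    rw [← hQdef, ← hBdef, ← hPdef]
    ring
  have h3 : ∑ j, (Q * g j - B * w j) ^ 2 = 0 := by
    refine le_antisymm ?_ (Finset.sum_nonneg fun j _ => sq_nonneg _)
    rw [h2]
    exact mul_nonpos_of_nonneg_of_nonpos hQ0.le (by omega)
  have h4 := (Finset.sum_eq_zero_iff_of_nonneg fun j _ => sq_nonneg _).mp h3 i (Finset.mem_univ i)
  exact sub_eq_zero.mp (pow_eq_zero_iff two_ne_zero |>.mp h4)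

end Optimization

/-! ### The canonical filtration and its uniqueness. -/

theorem mainTheorem12 {k : Type*} [Field k] [PerfectField k] (n : ℕ) (hn : 1 ≤ n)
    (x : Module.Basis (Fin (n + 1)) k (ModelFiliform k n)) (hx : IsVergneBasis x)
    (w : Fin (n + 1) → ℤ) (hw0 : w 0 = 12)
    (hw : ∀ i : Fin (n + 1), 1 ≤ i.val →
      w i = (n : ℤ) ^ 3 - 7 * (n : ℤ) + 18 + 12 * ((i.val : ℤ) - 1)) :
    ∃ F : LieAlgFiltration k (ModelFiliform k n),
      (∀ m : ℤ, F.piece m = Submodule.span k (x '' {i : Fin (n + 1) | m ≤ w i})) ∧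
      F.IsCanonical ∧
      ∀ G : LieAlgFiltration k (ModelFiliform k n), G.IsCanonical ↔ G.SameUpToScaling F := by
  have hadd : ∀ i j : Fin (n + 1), 1 ≤ i.val → j.val = i.val + 1 → w 0 + w i = w j := by
    intro i j hi hj
    rw [hw0, hw i hi, hw j (by omega), hj]
    push_cast
    ring
  -- The polynomial is `w 1 - 12 = (n - 1) (n - 2) (n + 3)`; its sign makes `w` monotone from index
  -- 0 on.
  have hcube : (0 : ℤ) ≤ (n : ℤ) ^ 3 - 7 * n + 6 := by
    rcases (by omega : n = 1 ∨ n = 2 ∨ 3 ≤ n) with rfl | rfl | h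
    · norm_num
    · norm_num
    · have : (3 : ℤ) ≤ n := by exact_mod_cast h
      nlinarith [mul_nonneg (by omega : (0 : ℤ) ≤ n) (by nlinarith : (0 : ℤ) ≤ (n : ℤ) ^ 2 - 9)]
  have hge : ∀ i, 12 ≤ w i := by
    intro i
    by_cases hi : i.val = 0
    · rw [show i = 0 from Fin.ext hi, hw0]
    · rw [hw i (by omega)]
      have : (1 : ℤ) ≤ i.val := by omega
      linarith
  have hmono : Monotone w := by
    intro i j hij
    by_cases hi : i.val = 0
    · rw [show i = 0 from Fin.ext hi, hw0]
      exact hge j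
    · rw [Fin.le_def] at hij
      rw [hw i (by omega), hw j (by omega)]
      omega
  set F := hx.filtration hn w fun i j hi hj => (hadd i j hi hj).le with hFdef
  have hF : F.HasFlagWeights x w := fun m i => isPivot_span_iff
  have hD : (0 : ℤ) < (n : ℤ) ^ 3 - n + 12 := by
    have : (0 : ℤ) ≤ n := by omega
    linarith
  have hW : 0 < ∑ i, w i :=
    Finset.sum_pos (fun i _ => by linarith [hge i]) Finset.univ_nonempty
  have hQ : ((n : ℤ) ^ 3 - n + 12) * ∑ i, w i = ∑ i, w i ^ 2 := by
    rw [kuhnTucker_identity hw0 hw w, Finset.sum_eq_zero (s := (Finset.univ : Finset (Fin n)))]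
    · rw [add_zero]
      exact Finset.sum_congr rfl fun i _ => (sq (w i)).symm
    · intro i _
      by_cases hi : i.val = 0
      · simp [hi]
      · rw [hadd i.castSucc i.succ (by simp only [Fin.val_castSucc]; omega) (by simp)]
        ring
  have hQ0 : 0 < ∑ i, w i ^ 2 := hQ ▸ mul_pos hD hW
  have unstable : ¬ LieAlgFiltration.IsSemistable k (ModelFiliform k n) := by
    intro h
    have := h F
    rw [hF.wt_eq] at this
    omega
  have scaling : ∀ G : LieAlgFiltration k (ModelFiliform k n), G.nu ≤ F.nu →
      G.SameUpToScaling F := by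
    intro G hle
    obtain ⟨g, hG⟩ := G.exists_hasFlagWeights x
    rw [hG.nu_eq, hF.nu_eq, neg_div, neg_div, neg_le_neg_iff] at hle
    have hW' : (0 : ℝ) < ((∑ i, w i : ℤ) : ℝ) := by exact_mod_cast hW
    have hQ' : (0 : ℝ) < ((∑ i, w i ^ 2 : ℤ) : ℝ) := by exact_mod_cast hQ0
    -- Positivity excludes zero norm, where the quotient would be 0 by convention.
    have hpos : (0 : ℝ) < ((∑ i, g i : ℤ) : ℝ) / Real.sqrt ((∑ i, g i ^ 2 : ℤ) : ℝ) :=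
      lt_of_lt_of_le (div_pos hW' (Real.sqrt_pos.mpr hQ')) hle
    have hP0 : (0 : ℝ) < Real.sqrt ((∑ i, g i ^ 2 : ℤ) : ℝ) :=
      lt_of_le_of_ne (Real.sqrt_nonneg _) fun h => by
        rw [← h, div_zero] at hpos
        exact hpos.false
    have hS' : (0 : ℝ) < ((∑ i, g i : ℤ) : ℝ) := (div_pos_iff_of_pos_right hP0).mp hpos
    have hS : 0 < ∑ i, g i := by exact_mod_cast hS'
    have hsq : (∑ i, w i) ^ 2 * ∑ i, g i ^ 2 ≤ (∑ i, g i) ^ 2 * ∑ i, w i ^ 2 := by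
      rw [div_le_div_iff₀ (Real.sqrt_pos.mpr hQ') hP0] at hle
      have h2 := pow_le_pow_left₀ (by positivity) hle 2
      rw [mul_pow, mul_pow, Real.sq_sqrt (Real.sqrt_pos.mp hP0).le, Real.sq_sqrt hQ'.le] at h2
      exact_mod_cast h2
    have hB : ((n : ℤ) ^ 3 - n + 12) * ∑ i, g i ≤ ∑ i, w i * g i := by
      rw [kuhnTucker_identity hw0 hw g]
      have : ∑ i : Fin n, 6 * (i.val : ℤ) * (n - i.val) * (g 0 + g i.castSucc - g i.succ) ≤ 0 := by
        refine Finset.sum_nonpos fun i _ => ?_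
        -- No bracket relates `g 0 + g 0` to `g 1`, but the multiplier vanishes at `i = 0`.
        by_cases hi : i.val = 0
        · simp [hi]
        · have h1 := hx.flagWeights_add_le hn hG i.castSucc i.succ
            (by simp only [Fin.val_castSucc]; omega) (by simp)
          have h2 := i.isLt
          exact mul_nonpos_of_nonneg_of_nonpos
            (mul_nonneg (by positivity) (by omega)) (by linarith)
      linarith
    have hprop := proportional_of_sq_le hD hS hQ hW hB hsq
    have hB0 : 0 < ∑ i, w i * g i := lt_of_lt_of_le (mul_pos hD hS) hB
    have hg0 : 0 < g 0 := by
      have h := hprop 0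
      rw [hw0] at h
      exact pos_of_mul_pos_right (h ▸ mul_pos hB0 (by norm_num)) hQ0.le
    -- The factors are `w 0 = 12` and `g 0`, since proportionality reads `w 0 * g i = g 0 * w i`.
    refine hG.sameUpToScaling hF hmono (p := 12) (q := (g 0).toNat) (by norm_num) (by omega)
      fun i => ?_
    rw [Int.toNat_of_nonneg hg0.le]
    refine mul_left_cancel₀ hQ0.ne' ?_
    have h0 := hprop 0
    have hi := hprop i
    rw [hw0] at h0
    push_cast
    linear_combination 12 * hi - w i * h0
  have nu_eq : ∀ G : LieAlgFiltration k (ModelFiliform k n), G.SameUpToScaling F →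
      G.nu = F.nu := by
    intro G h
    obtain ⟨g, hG⟩ := G.exists_hasFlagWeights x
    obtain ⟨p, q, hp, hq, hpq⟩ := h.flagWeights hG hF
    exact hG.nu_eq_of_proportional hF hp hq hpq
  -- A filtration doing at least as well as `F` is a rescaling of `F`, so it has the same `nu`.
  have hmin : ∀ G : LieAlgFiltration k (ModelFiliform k n), F.nu ≤ G.nu := fun G =>
    (le_total F.nu G.nu).elim id fun h => (nu_eq G (scaling G h)).ge
  refine ⟨F, fun m => rfl, Or.inr ⟨unstable, hmin⟩, fun G => ⟨?_, fun h => ?_⟩⟩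
  · rintro (⟨h, -⟩ | ⟨-, h⟩)
    · exact absurd h unstable
    · exact scaling G (h F)
  · exact Or.inr ⟨unstable, fun H => (nu_eq G h).trans_le (hmin H)⟩
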